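/- Let $V=\mathbb C^3$ with the Hermitian form $\langle x,y\rangle=x_1\overline{y_1}+x_2\overline{y_2}-x_3\overline{y_3}$, let $\mathrm{SU}(2,1)$ be the group of linear automorphisms of $V$ of determinant $1$ preserving this form, and let $\mathrm{PU}(2,1)=\mathrm{SU}(2,1)/\{1,\omega,\omega^2\}$ with $\omega=e^{2\pi i/3}$. A *parameter* is a complex number $\alpha$ with $|\alpha|=1$ and $\alpha^3\neq 1$. For a parameter $\alpha$ and $p\in V$ with $\langle p,p\rangle\neq 0$ put $$R_\alpha^p(x)=(\alpha^{-2}-\alpha)\frac{\langle x,p\rangle}{\langle p,p\rangle}\,p+\alpha x ,$$ an element of $\mathrm{SU}(2,1)$ depending only on $\alpha$ and the line $\mathbb Cp$. A nonidentical element of $\mathrm{PU}(2,1)$ is *elliptic* if it fixes a point $\mathbb Cc$ with $\langle c,c\rangle<0$; it is *special elliptic* if moreover the three eigenvalues of a lift to $\mathrm{SU}(2,1)$ are not pairwise distinct. It *has positive center* if it has a lift of the form $R_\beta^q$ with $\beta$ a parameter and $\langle q,q\rangle>0$. **Proposition.** Let $\alpha$ be a parameter. Every special elliptic isometry $F\in\mathrm{PU}(2,1)$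 with positive center admits an $\alpha^{(3)}$-decomposition: there are $p_1,p_2,p_3\in V$ with $\langle p_i,p_i\rangle\neq 0$ such that $R_\alpha^{p_3}R_\alpha^{p_2}R_\alpha^{p_1}$ is a lift of $F$ to $\mathrm{SU}(2,1)$. -/

import Mathlib

noncomputable section

namespace ComplexHyperbolic

/-- The underlying complex vector space of dimension three. -/
abbrev V : Type := Fin 3 → ℂ

/-- The standard Hermitian form of signature `++-`, linear in the first argument. -/
def herm (x y : V) : ℂ :=
  x 0 * star (y 0) + x 1 * star (y 1) - x 2 * star (y 2)

/-- A nonzero vector representing a negative point of the projective plane,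
i.e. a point of the complex hyperbolic plane. -/
def IsNegative (p : V) : Prop := (herm p p).re < 0

/-- A vector representing a positive point of the projective plane. -/
def IsPositive (p : V) : Prop := 0 < (herm p p).re

/-- A vector representing a nonisotropic point of the projective plane. -/
def IsNonisotropic (p : V) : Prop := herm p p ≠ 0

/-- `SU(2,1)`: matrices of determinant one preserving the Hermitian form. -/
def SU21 : Subgroup (Matrix.SpecialLinearGroup (Fin 3) ℂ) where
  carrier := {A | ∀ x y : V, herm (A.1.mulVec x) (A.1.mulVec y) = herm x y}
  one_mem' := by
    intro x y
    simp
  mul_mem' := by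
    intro A B hA hB x y
    have h := (hA (B.1.mulVec x) (B.1.mulVec y)).trans (hB x y)
    simpa only [Matrix.mulVec_mulVec, Matrix.SpecialLinearGroup.coe_mul] using h
  inv_mem' := by
    intro A hA x y
    have hx : ∀ z : V, A.1.mulVec ((A⁻¹).1.mulVec z) = z := by
      intro z
      rw [Matrix.mulVec_mulVec, ← Matrix.SpecialLinearGroup.coe_mul, mul_inv_cancel]
      simp
    have h := hA ((A⁻¹).1.mulVec x) ((A⁻¹).1.mulVec y)
    rw [hx, hx] at h
    exact h.symm

/-- The matrix underlying an element of `SU(2,1)`. -/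
def toMat (A : SU21) : Matrix (Fin 3) (Fin 3) ℂ := A.1.1

/-- The subgroup of scalar matrices in `SU(2,1)`; the determinant condition makes the scalars
exactly the cube roots of unity. -/
def scalars : Subgroup SU21 where
  carrier := {A | ∃ c : ℂ, toMat A = c • (1 : Matrix (Fin 3) (Fin 3) ℂ)}
  one_mem' := ⟨1, by simp [toMat]⟩
  mul_mem' := by
    rintro A B ⟨a, ha⟩ ⟨b, hb⟩
    refine ⟨a * b, ?_⟩
    have h : toMat (A * B) = toMat A * toMat B := by simp [toMat]
    rw [h, ha, hb]
    simp [smul_smul, mul_comm]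
  inv_mem' := by
    rintro A ⟨a, ha⟩
    have h : toMat A⁻¹ * toMat A = 1 := by
      have h2 : toMat (A⁻¹ * A) = 1 := by
        rw [inv_mul_cancel]
        simp [toMat]
      rw [← h2]
      simp only [toMat, Subgroup.coe_mul, Matrix.SpecialLinearGroup.coe_mul]
    rw [ha, mul_smul_comm, mul_one] at h
    have h0 : a ≠ 0 := by
      rintro rfl
      rw [zero_smul] at h
      exact zero_ne_one h
    refine ⟨a⁻¹, ?_⟩
    rw [← h, smul_smul, inv_mul_cancel₀ h0, one_smul]

instance scalars_normal : scalars.Normal where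
  conj_mem := by
    rintro A ⟨a, ha⟩ g
    refine ⟨a, ?_⟩
    have h : toMat (g * A * g⁻¹) = toMat g * toMat A * toMat (g⁻¹) := by
      simp only [toMat, Subgroup.coe_mul, Matrix.SpecialLinearGroup.coe_mul]
    have h2 : toMat g * toMat (g⁻¹) = 1 := by
      have h3 : toMat (g * g⁻¹) = 1 := by
        rw [mul_inv_cancel]
        simp [toMat]
      rw [← h3]
      simp only [toMat, Subgroup.coe_mul, Matrix.SpecialLinearGroup.coe_mul]
    rw [h, ha, mul_smul_comm, mul_one, smul_mul_assoc, h2]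

/-- `PU(2,1)`, the group of orientation-preserving isometries of the complex hyperbolic plane. -/
abbrev PU21 : Type := SU21 ⧸ scalars

/-- `A ∈ SU(2,1)` is a lift of `F ∈ PU(2,1)`. -/
def IsLift (A : SU21) (F : PU21) : Prop := (QuotientGroup.mk A : PU21) = F

/-- A parameter: a unit complex number that is not a cube root of unity. -/
def IsParameter (α : ℂ) : Prop := ‖α‖ = 1 ∧ α ^ 3 ≠ 1

/-- The linear map `R_α^p`, as a matrix. -/
def R (α : ℂ) (p : V) : Matrix (Fin 3) (Fin 3) ℂ :=
  ((α⁻¹ ^ 2 - α) / herm p p) •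
    Matrix.vecMulVec p ![star (p 0), star (p 1), -star (p 2)] + α • 1

/-- The defining formula of `R_α^p`. -/
theorem R_mulVec (α : ℂ) (p x : V) :
    (R α p).mulVec x = ((α⁻¹ ^ 2 - α) * (herm x p / herm p p)) • p + α • x := by
  ext i
  simp only [R, Matrix.add_mulVec, Matrix.smul_mulVec, Matrix.one_mulVec, Matrix.vecMulVec_mulVec,
    dotProduct, Fin.sum_univ_three, herm, Pi.add_apply, Pi.smul_apply, smul_eq_mul,
    Matrix.cons_val_zero, Matrix.cons_val_one, Matrix.cons_val, MulOpposite.smul_eq_mul_unop,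
    MulOpposite.unop_op]
  ring

/-- A nonidentical isometry is elliptic if it fixes a point of the complex hyperbolic plane. -/
def IsElliptic (F : PU21) : Prop :=
  F ≠ 1 ∧ ∃ A : SU21, IsLift A F ∧
    ∃ c : V, IsNegative c ∧ ∃ μ : ℂ, (toMat A).mulVec c = μ • c

/-- An elliptic isometry is special if the three eigenvalues (with multiplicity) of a lift of it
are not pairwise distinct. -/
def IsSpecialElliptic (F : PU21) : Prop :=
  IsElliptic F ∧ ∃ A : SU21, IsLift A F ∧ ¬ (toMat A).charpoly.roots.Nodup

/-- The nonisotropic point `p` is the center of `F`: `F` lifts to `R_β^p` for a parameter `β`. -/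
def HasCenter (F : PU21) (p : V) : Prop :=
  IsNonisotropic p ∧ ∃ β : ℂ, IsParameter β ∧ ∃ A : SU21, IsLift A F ∧ toMat A = R β p

/-- `F` admits an `(α_0, …, α_{n-1})`-decomposition: it has a lift equal to
`R_{α_{n-1}}^{p_{n-1}} ⋯ R_{α_0}^{p_0}` for some nonisotropic points `p_i`. -/
def AdmitsDecomposition {n : ℕ} (α : Fin n → ℂ) (F : PU21) : Prop :=
  ∃ A : SU21, IsLift A F ∧ ∃ p : Fin n → V, (∀ i, IsNonisotropic (p i)) ∧
    toMat A = (List.ofFn fun i => R (α i) (p i)).reverse.prod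

/-- `F` admits an `α^(n)`-decomposition. -/
def AdmitsPowDecomposition (α : ℂ) (n : ℕ) (F : PU21) : Prop :=
  AdmitsDecomposition (fun _ : Fin n => α) F

end ComplexHyperbolic

end

namespace ComplexHyperbolic

open Matrix

/-! Multiplying the lift R_β^q by a cube root of unity δ gives R_γ^q with γ = δβ, and δ can be
chosen with Re γ < -1/2 (`exists_cube_root_mul_re_lt`). It remains to write R_γ^q itself as a triple
product (`exists_R_triple_eq`).

Seek centers of equal norm n = ±1 with ⟨p_i, p_j⟩ = nν for i < j, where (1 - α⁻³)ν = 1 - γ⁻¹. By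
`R_triple_mulVec`, if the p_i have the same q-component, q is an eigenvector as soon as p₁ + γ⁻¹p₂ +
γ⁻²p₃ lies in ℂq. These requirements determine the Gram matrix of the projections s, t of p₁, p₂ to
q^⊥. As q is positive, q^⊥ has signature (1,1), so s and t exist when their Gram determinant is
negative (`exists_pair_of_gram`). Unless γ = α³, where all p_i can be q, this is exactly Re γ <
-1/2. The product is then γ on q^⊥ and γ⁻² on q. -/

/-! ### Sesquilinearity of the form -/

theorem herm_add_left (x y z : V) : herm (x + y) z = herm x z + herm y z := by
  simp only [herm, Pi.add_apply]; ring

theorem herm_add_right (x y z : V) : herm x (y + z) = herm x y + herm x z := by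
  simp only [herm, Pi.add_apply, star_add]; ring

theorem herm_smul_left (c : ℂ) (x y : V) : herm (c • x) y = c * herm x y := by
  simp only [herm, Pi.smul_apply, smul_eq_mul]; ring

theorem herm_smul_right (c : ℂ) (x y : V) : herm x (c • y) = star c * herm x y := by
  simp only [herm, Pi.smul_apply, smul_eq_mul, star_mul']; ring

theorem star_herm (x y : V) : star (herm x y) = herm y x := by
  simp only [herm, star_add, star_sub, star_mul', star_star]; ring

/-! ### Vectors with prescribed Gram matrix in q^⊥ -/

/-- The orthogonal complement of a positive vector contains a hyperbolic pair. -/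
theorem exists_hyperbolic_pair {q : V} (hq : IsPositive q) :
    ∃ l m : V, herm l q = 0 ∧ herm m q = 0 ∧ herm l l = 0 ∧ herm m m = 0 ∧ herm l m = 1 := by
  obtain ⟨f, g, hfq, hgq, hfg, hff, hgg⟩ : ∃ f g : V, herm f q = 0 ∧ herm g q = 0 ∧
      herm f g = 0 ∧ herm f f = 1 ∧ herm g g = -1 := by
    set a := q 0 with ha
    set b := q 1 with hb
    set c := q 2 with hc
    set M : ℝ := Complex.normSq a + Complex.normSq b with hM
    have hMc : (M : ℂ) = a * star a + b * star b := by
      simp only [hM, Complex.ofReal_add, Complex.normSq_eq_conj_mul_self, starRingEnd_apply]; ring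
    have hpos : 0 < M - Complex.normSq c := by
      have h := hq
      have e : herm q q = ((M - Complex.normSq c : ℝ) : ℂ) := by
        simp only [herm, Complex.ofReal_sub, hMc, Complex.normSq_eq_conj_mul_self,
          starRingEnd_apply]
        ring
      rwa [IsPositive, e, Complex.ofReal_re] at h
    have hM0 : 0 < M := by linarith [Complex.normSq_nonneg c]
    have hcc : ((Complex.normSq c : ℝ) : ℂ) = c * star c := by
      rw [Complex.normSq_eq_conj_mul_self, starRingEnd_apply, mul_comm]
    have hsM : star (M : ℂ) = M := Complex.conj_ofReal M
    set N : ℝ := M * (M - Complex.normSq c) with hN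
    have hN0 : 0 < N := mul_pos hM0 hpos
    have hNc : (N : ℂ) = M * (M - c * star c) := by rw [hN]; push_cast; rw [hcc]
    have key : ∀ r : ℝ, 0 < r → ((Real.sqrt r)⁻¹ : ℂ) * ((Real.sqrt r)⁻¹ : ℂ) * (r : ℂ) = 1 := by
      intro r hr
      have h1 : (Real.sqrt r)⁻¹ * (Real.sqrt r)⁻¹ * r = 1 := by
        have h2 := Real.mul_self_sqrt hr.le
        have h3 := Real.sqrt_pos.2 hr
        field_simp
        nlinarith
      exact_mod_cast h1
    have hstar : ∀ r : ℝ, star ((Real.sqrt r)⁻¹ : ℂ) = ((Real.sqrt r)⁻¹ : ℂ) := by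
      intro r
      rw [← Complex.ofReal_inv]
      exact Complex.conj_ofReal _
    -- The unnormalized first vector spans the part of q^⊥ with zero last coordinate; the second is
    -- orthogonal to it and to q, with norm -N.
    refine ⟨((Real.sqrt M)⁻¹ : ℂ) • ![-star b, star a, 0],
      ((Real.sqrt N)⁻¹ : ℂ) • ![a * star c, b * star c, M], ?_, ?_, ?_, ?_, ?_⟩
    · rw [herm_smul_left]
      simp [herm, ← ha, ← hb]
      right; ring
    · rw [herm_smul_left]
      have : herm ![a * star c, b * star c, (M : ℂ)] q = 0 := by
        simp only [herm, cons_val_zero, cons_val_one, cons_val, ← ha, ← hb, ← hc, hMc]; ring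
      rw [this, mul_zero]
    · rw [herm_smul_left, herm_smul_right]
      have : herm ![-star b, star a, 0] ![a * star c, b * star c, (M : ℂ)] = 0 := by
        simp only [herm, cons_val_zero, cons_val_one, cons_val, star_mul', star_star]; ring
      rw [this, mul_zero, mul_zero]
    · rw [herm_smul_left, herm_smul_right, hstar, ← mul_assoc]
      have : herm ![-star b, star a, 0] ![-star b, star a, 0] = M := by
        simp only [herm, cons_val_zero, cons_val_one, cons_val, star_neg, star_star, hMc]; ring
      rw [this, key M hM0]
    · rw [herm_smul_left, herm_smul_right, hstar, ← mul_assoc]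
      have : herm ![a * star c, b * star c, (M : ℂ)] ![a * star c, b * star c, (M : ℂ)]
          = -(N : ℂ) := by
        simp only [herm, cons_val_zero, cons_val_one, cons_val, star_mul', star_star, hsM, hNc]
        rw [hMc]; ring
      rw [this, mul_neg, key N hN0]
  have hgf : herm g f = 0 := by rw [← star_herm, hfg, star_zero]
  have h2 : star (-1 / 2 : ℂ) = -1 / 2 := by
    simp [star_div₀]
  have h3 : star (1 / 2 : ℂ) = 1 / 2 := by
    simp
  refine ⟨f + g, (1 / 2 : ℂ) • f + (-1 / 2 : ℂ) • g, ?_, ?_, ?_, ?_, ?_⟩ <;>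
    simp only [herm_add_left, herm_add_right, herm_smul_left, herm_smul_right, hfq, hgq, hfg, hgf,
      hff, hgg, h2, h3] <;> norm_num

/-- The orthogonal complement of a positive vector contains all pairs of vectors of equal
norm whose Gram determinant is negative. -/
theorem exists_pair_of_gram {q : V} (hq : IsPositive q) (σ : ℝ) (η : ℂ)
    (h : σ ^ 2 < Complex.normSq η) :
    ∃ s t : V, herm s q = 0 ∧ herm t q = 0 ∧ herm s s = σ ∧ herm t t = σ ∧ herm s t = η := by
  obtain ⟨l, m, hlq, hmq, hll, hmm, hlm⟩ := exists_hyperbolic_pair hq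
  have hml : herm m l = 1 := by rw [← star_herm, hlm, star_one]
  set e := Complex.normSq η with he
  obtain ⟨r, hr⟩ : ∃ r : ℝ, e * (2 * r - r ^ 2 * σ) = σ := by
    have he0 : 0 < e := lt_of_le_of_lt (sq_nonneg σ) h
    have hd : 0 ≤ e ^ 2 - σ ^ 2 * e := by nlinarith
    have hs := Real.sq_sqrt hd
    have hs0 := Real.sqrt_nonneg (e ^ 2 - σ ^ 2 * e)
    set S := Real.sqrt (e ^ 2 - σ ^ 2 * e)
    -- A root of the quadratic eσr² - 2er + σ, rationalized so that it also covers σ = 0. The square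
    -- root is real because σ² < e.
    refine ⟨σ / (e + S), ?_⟩
    have : e + S ≠ 0 := by positivity
    field_simp
    linear_combination (-σ) * hs
  have hec : (e : ℂ) = star η * η := by
    rw [he, Complex.normSq_eq_conj_mul_self, starRingEnd_apply]
  have hrc : (star η * η) * (2 * (r : ℂ) - (r : ℂ) ^ 2 * σ) = σ := by
    rw [← hec]; exact_mod_cast hr
  have sσ : star (σ : ℂ) = σ := Complex.conj_ofReal σ
  have sr : star (r : ℂ) = r := Complex.conj_ofReal r
  have s2 : star (2 : ℂ) = 2 := by simp
  -- For every real r these satisfy ⟨s, s⟩ = σ and ⟨s, t⟩ = η; the choice of r adjusts ⟨t, t⟩.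
  refine ⟨l + ((σ : ℂ) / 2) • m,
    ((r : ℂ) * star η) • l + (star η * (1 - r * σ / 2)) • m, ?_, ?_, ?_, ?_, ?_⟩ <;>
    simp only [herm_add_left, herm_add_right, herm_smul_left, herm_smul_right, hlq, hmq, hll, hmm,
      hlm, hml, star_mul', star_div₀, star_sub, star_star, star_one, sσ, sr, s2]
  · ring
  · ring
  · ring
  · linear_combination hrc
  · ring

/-! ### Choice of the lift -/

/-- Some multiple of a parameter by a cube root of unity has real part less than `-1/2`. -/
theorem exists_cube_root_mul_re_lt {β : ℂ} (hβ : IsParameter β) :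
    ∃ δ : ℂ, δ ^ 3 = 1 ∧ (δ * β).re < -1 / 2 := by
  obtain ⟨h1, h3⟩ := hβ
  have hn : β.re ^ 2 + β.im ^ 2 = 1 := by
    have := Complex.sq_norm β
    rw [h1, Complex.normSq_apply] at this
    linarith
  have hs : Real.sqrt 3 ^ 2 = 3 := Real.sq_sqrt (by norm_num)
  have hre : (β ^ 3).re < 1 := by
    have hn3 : ‖β ^ 3‖ = 1 := by rw [norm_pow, h1, one_pow]
    refine lt_of_le_of_ne (hn3 ▸ Complex.re_le_norm _) fun h => h3 ?_
    have h4 := Complex.sq_norm (β ^ 3)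
    rw [hn3, Complex.normSq_apply, h] at h4
    have him : (β ^ 3).im = 0 := by nlinarith
    exact Complex.ext h him
  have hre' : (β ^ 3).re = β.re ^ 3 - 3 * β.re * β.im ^ 2 := by
    simp only [pow_succ, pow_zero, one_mul, Complex.mul_re, Complex.mul_im]; ring
  rw [hre'] at hre
  by_contra! hcon
  have a0 := hcon 1 (one_pow 3)
  have hcube : ∀ t : ℝ, t ^ 2 = 3 → (⟨-1 / 2, t / 2⟩ : ℂ) ^ 3 = 1 := by
    intro t ht
    apply Complex.ext
    · simp [pow_succ]
      linear_combination (3 / 8) * ht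
    · simp [pow_succ]
      linear_combination (-t / 8) * ht
  have a1 := hcon _ (hcube (Real.sqrt 3) hs)
  have a2 := hcon _ (hcube (-Real.sqrt 3) (by rw [neg_sq, hs]))
  simp only [Complex.mul_re, one_mul] at a0 a1 a2
  have hp := mul_nonneg (mul_nonneg (sub_nonneg.2 a0) (sub_nonneg.2 a1)) (sub_nonneg.2 a2)
  generalize Real.sqrt 3 = t at *
  generalize β.re = x at *
  generalize β.im = y at *
  have hy : y ^ 2 = 1 - x ^ 2 := by linarith
  -- The product of Re(δβ) + 1/2 over the three cube roots δ is (Re β³ - 1)/4, which is negative, so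
  -- the factors cannot all be nonnegative.
  have : (x - -1 / 2) * (-1 / 2 * x - t / 2 * y - -1 / 2) * (-1 / 2 * x - -t / 2 * y - -1 / 2)
      = (x ^ 3 - 3 * x * y ^ 2 - 1) / 4 := by
    have e : (x - -1 / 2) * (-1 / 2 * x - t / 2 * y - -1 / 2) *
        (-1 / 2 * x - -t / 2 * y - -1 / 2)
      = (x + 1 / 2) * ((1 - x) ^ 2 / 4 - t ^ 2 * y ^ 2 / 4) := by ring
    rw [e, hs, hy]; ring
  linarith

/-! ### Products of three reflections -/

/-- A product of three reflections with a common parameter whose centers have equal norms and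
equal upper triangular Gram entries. -/
theorem R_triple_mulVec {α n ν : ℂ} (hα : α ≠ 0) {p₁ p₂ p₃ : V}
    (h₁ : herm p₁ p₁ = n) (h₂ : herm p₂ p₂ = n) (h₃ : herm p₃ p₃ = n) (hn : n ≠ 0)
    (h₁₂ : herm p₁ p₂ = n * ν) (h₁₃ : herm p₁ p₃ = n * ν) (h₂₃ : herm p₂ p₃ = n * ν)
    {γ : ℂ} (hν : (1 - (α ^ 3)⁻¹) * ν = 1 - γ⁻¹) (x : V) {u₁ u₂ u₃ : ℂ}
    (hu₁ : herm x p₁ = n * u₁) (hu₂ : herm x p₂ = n * u₂) (hu₃ : herm x p₃ = n * u₃) :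
    (R α p₃ * R α p₂ * R α p₁).mulVec x = α ^ 3 • x + ((1 - α ^ 3) * u₁) • p₁ +
      ((1 - α ^ 3) * (u₂ - (1 - γ⁻¹) * u₁)) • p₂ +
      ((1 - α ^ 3) * (u₃ - (1 - γ⁻¹) * u₂ - (1 - γ⁻¹) * γ⁻¹ * u₁)) • p₃ := by
  have e1 : (R α p₁).mulVec x = ((α⁻¹ ^ 2 - α) * u₁) • p₁ + α • x := by
    rw [R_mulVec, h₁, hu₁, mul_div_cancel_left₀ _ hn]
  have e2 : (R α p₂).mulVec ((R α p₁).mulVec x) =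
      ((α⁻¹ ^ 2 - α) * α * (u₂ - (1 - γ⁻¹) * u₁)) • p₂ + α • (R α p₁).mulVec x := by
    rw [R_mulVec, h₂]
    congr 2
    rw [e1, herm_add_left, herm_smul_left, herm_smul_left, h₁₂, hu₂, ← hν]
    field_simp
    ring
  rw [← mulVec_mulVec, ← mulVec_mulVec, R_mulVec, h₃]
  have e3 : herm ((R α p₂).mulVec ((R α p₁).mulVec x)) p₃ =
      n * (α ^ 2 * (u₃ - (1 - γ⁻¹) * u₂ - (1 - γ⁻¹) * γ⁻¹ * u₁)) := by
    rw [e2, e1]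
    simp only [herm_add_left, herm_smul_left, h₁₃, h₂₃, hu₃]
    -- Pairing with an earlier center produces (1 - α⁻³)ν; writing it as 1 - γ⁻¹ removes α from the
    -- inner coefficients.
    have hγ : γ⁻¹ = 1 - (1 - (α ^ 3)⁻¹) * ν := by rw [hν]; ring
    rw [hγ]
    field_simp
    ring
  rw [e3, mul_div_cancel_left₀ _ hn, e2, e1]
  simp only [smul_add, smul_smul]
  have c1 : α * (α * ((α⁻¹ ^ 2 - α) * u₁)) = (1 - α ^ 3) * u₁ := by field_simp
  have c2 : α * ((α⁻¹ ^ 2 - α) * α * (u₂ - (1 - γ⁻¹) * u₁)) =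
      (1 - α ^ 3) * (u₂ - (1 - γ⁻¹) * u₁) := by field_simp
  have c3 : (α⁻¹ ^ 2 - α) * (α ^ 2 * (u₃ - (1 - γ⁻¹) * u₂ - (1 - γ⁻¹) * γ⁻¹ * u₁)) =
      (1 - α ^ 3) * (u₃ - (1 - γ⁻¹) * u₂ - (1 - γ⁻¹) * γ⁻¹ * u₁) := by field_simp
  rw [c1, c2, c3, show α * (α * α) = α ^ 3 by ring]
  abel

/-- Two matrices agreeing on a nonisotropic vector and on two vectors orthogonal to it with
nonzero Gram determinant are equal. -/
theorem matrix_eq_of_mulVec_eq {A B : Matrix (Fin 3) (Fin 3) ℂ} {q s t : V}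
    (hq : herm q q ≠ 0) (hs : herm s q = 0) (ht : herm t q = 0)
    (hdet : herm s s * herm t t - herm s t * herm t s ≠ 0)
    (hAq : A.mulVec q = B.mulVec q) (hAs : A.mulVec s = B.mulVec s)
    (hAt : A.mulVec t = B.mulVec t) : A = B := by
  have hli : LinearIndependent ℂ ![q, s, t] := by
    rw [Fintype.linearIndependent_iff]
    intro g hg
    simp only [Fin.sum_univ_three, cons_val_zero, cons_val_one, cons_val] at hg
    have key : ∀ y : V, g 0 * herm q y + g 1 * herm s y + g 2 * herm t y = 0 := by
      intro y
      rw [← herm_smul_left, ← herm_smul_left, ← herm_smul_left, ← herm_add_left,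
        ← herm_add_left, hg]
      simp [herm]
    have hqs : herm q s = 0 := by rw [← star_herm, hs, star_zero]
    have hqt : herm q t = 0 := by rw [← star_herm, ht, star_zero]
    have k0 := key q
    have k1 := key s
    have k2 := key t
    rw [hs, ht, mul_zero, mul_zero, add_zero, add_zero] at k0
    rw [hqs, mul_zero, zero_add] at k1
    rw [hqt, mul_zero, zero_add] at k2
    have g0 : g 0 = 0 := (mul_eq_zero.1 k0).resolve_right hq
    have g1 : g 1 = 0 := by
      refine (mul_eq_zero.1 ?_).resolve_right hdet
      linear_combination herm t t * k1 - herm t s * k2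
    have g2 : g 2 = 0 := by
      refine (mul_eq_zero.1 ?_).resolve_right hdet
      linear_combination herm s s * k2 - herm s t * k1
    intro i
    fin_cases i
    exacts [g0, g1, g2]
  have hb := hli.span_eq_top_of_card_eq_finrank' (by simp)
  have : A.mulVecLin = B.mulVecLin := by
    refine LinearMap.ext_on_range hb fun i => ?_
    fin_cases i
    exacts [hAq, hAs, hAt]
  exact Matrix.toLin'.injective this

theorem R_mulVec_self {β : ℂ} {q : V} (hq : herm q q ≠ 0) :
    (R β q).mulVec q = (β⁻¹ ^ 2) • q := by
  rw [R_mulVec, div_self hq, ← add_smul]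
  congr 1
  ring

theorem R_mulVec_of_herm_eq_zero {β : ℂ} {q x : V} (hx : herm x q = 0) :
    (R β q).mulVec x = β • x := by
  rw [R_mulVec, hx]
  simp

theorem star_eq_inv_of_norm_eq_one {z : ℂ} (hz : ‖z‖ = 1) : star z = z⁻¹ :=
  (Complex.inv_eq_conj hz).symm

/-! ### Construction of the centers -/

/-- The product of three reflections in suitable centers is `R γ q`, when `1 + 2 Re γ < 0`. -/
theorem exists_R_triple_eq {α γ : ℂ} (hα : IsParameter α) (hγ : ‖γ‖ = 1)
    (hre : γ.re < -1 / 2) {q : V} (hq : IsPositive q) :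
    ∃ p₁ p₂ p₃ : V, IsNonisotropic p₁ ∧ IsNonisotropic p₂ ∧ IsNonisotropic p₃ ∧
      R α p₃ * R α p₂ * R α p₁ = R γ q := by
  have hα0 : α ≠ 0 := by rintro rfl; simpa using hα.1
  have hγ0 : γ ≠ 0 := by rintro rfl; simp at hγ
  have hq0 : herm q q ≠ 0 := by
    intro h
    rw [IsPositive, h] at hq
    simp at hq
  obtain ⟨N, hN, hN0⟩ : ∃ N : ℝ, herm q q = N ∧ 0 < N := by
    refine ⟨(herm q q).re, ?_, hq⟩
    exact (Complex.conj_eq_iff_re.1 (star_herm q q)).symm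
  obtain ⟨w, hw⟩ : ∃ w, w = α ^ 3 := ⟨_, rfl⟩
  have hw1 : 1 - w ≠ 0 := by rw [hw]; exact sub_ne_zero.2 (Ne.symm hα.2)
  have hw0 : w ≠ 0 := by rw [hw]; exact pow_ne_zero 3 hα0
  have sw : star w = w⁻¹ := star_eq_inv_of_norm_eq_one (by rw [hw, norm_pow, hα.1, one_pow])
  have sγ : star γ = γ⁻¹ := star_eq_inv_of_norm_eq_one hγ
  have hden : 1 + γ + γ ^ 2 ≠ 0 := by
    intro h
    have h2 : γ + star γ = -1 := by
      rw [sγ]; field_simp; linear_combination h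
    have h3 := congrArg Complex.re h2
    simp at h3
    linarith
  -- For γ = α³ the number E below vanishes and the Gram matrix degenerates, but (R_α^q)³ already
  -- works.
  by_cases hwγ : w = γ
  · refine ⟨q, q, q, hq0, hq0, hq0, ?_⟩
    have hν : (1 - (α ^ 3)⁻¹) * 1 = 1 - γ⁻¹ := by rw [← hw, hwγ, mul_one]
    refine Matrix.toLin'.injective (LinearMap.ext fun x => ?_)
    have hx : herm x q = herm q q * (herm x q / herm q q) := (mul_div_cancel₀ _ hq0).symm
    have h1 : herm q q = herm q q * 1 := (mul_one _).symm
    rw [toLin'_apply, toLin'_apply,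
      R_triple_mulVec hα0 rfl rfl rfl hq0 h1 h1 h1 hν x hx hx hx, R_mulVec, ← hw, hwγ]
    generalize herm x q / herm q q = u
    match_scalars
    · ring
    · field_simp
      ring
  -- The projections of the centers to q^⊥ will have norm n(1 - k) and upper Gram entries nE. The
  -- relation γ²s + γt + p₃' = 0, with p₃' the projection of p₃, forces 1 - k = -E(γ + γ²); then k +
  -- E = ν gives E.
  obtain ⟨E, hE⟩ : ∃ E, E = -(1 - w * γ⁻¹) / ((1 - w) * (1 + γ + γ ^ 2)) := ⟨_, rfl⟩
  have hwγ' : 1 - w * γ⁻¹ ≠ 0 := by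
    intro h; apply hwγ; field_simp at h; linear_combination -h
  have hE0 : E ≠ 0 := by
    rw [hE]; exact div_ne_zero (neg_ne_zero.2 hwγ') (mul_ne_zero hw1 hden)
  have hET : (1 - w) * E * (1 + γ + γ ^ 2) = -(1 - w * γ⁻¹) := by
    rw [hE]; field_simp
  have hET' : (1 - w) * E * (1 + γ + γ ^ 2) * γ = w - γ := by
    rw [hET]; field_simp; ring
  have hw1' : 1 - w⁻¹ ≠ 0 := by
    intro h; apply hw1; field_simp at h; linear_combination -h
  have hden' : 1 + γ⁻¹ + γ⁻¹ ^ 2 ≠ 0 := by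
    intro h; apply hden; field_simp at h; linear_combination h
  have sE : star E = E * γ ^ 3 := by
    rw [hE]
    simp only [star_div₀, star_neg, star_sub, star_one, star_mul', star_add, star_pow, star_inv₀,
      sw, sγ, inv_inv]
    rw [div_mul_eq_mul_div, div_eq_div_iff (mul_ne_zero hw1' hden') (mul_ne_zero hw1 hden)]
    field_simp
    ring
  obtain ⟨k, hk⟩ : ∃ k : ℝ, (k : ℂ) = 1 + E * (γ + γ ^ 2) := by
    refine ⟨(1 + E * (γ + γ ^ 2)).re, Complex.conj_eq_iff_re.1 ?_⟩
    change star _ = _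
    simp only [star_add, star_mul', star_one, star_pow, sE, sγ]
    field_simp
    ring
  have hν : (1 - w⁻¹) * (k + E) = 1 - γ⁻¹ := by
    have : (1 - w) * ((k + E) : ℂ) = w * γ⁻¹ - w := by
      rw [hk]; linear_combination hET
    field_simp at this ⊢
    linear_combination -this
  have hkk : (1 - w) * k * (1 + γ⁻¹ + γ⁻¹ ^ 2) = γ⁻¹ ^ 2 - w := by
    rw [hk]; field_simp at hET ⊢; linear_combination (1 + γ) * hET
  -- The common q-component cq must have norm nk; since q is positive, n takes the sign of k.
  obtain ⟨n, hn2, c, hc⟩ : ∃ n : ℝ, n * n = 1 ∧ ∃ c : ℝ, c * c * N = n * k := by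
    have main : ∀ n : ℝ, 0 ≤ n * k → ∃ c : ℝ, c * c * N = n * k := fun n h =>
      ⟨Real.sqrt (n * k / N), by rw [Real.mul_self_sqrt (by positivity)]; field_simp⟩
    rcases le_total 0 k with h | h
    · exact ⟨1, by norm_num, main 1 (by linarith)⟩
    · exact ⟨-1, by norm_num, main (-1) (by linarith)⟩
  have hnc : (n : ℂ) * n = 1 := by exact_mod_cast hn2
  have hn0 : (n : ℂ) ≠ 0 := left_ne_zero_of_mul_eq_one hnc
  have hcc : (c : ℂ) * c * N = n * k := by exact_mod_cast hc
  have sn : star (n : ℂ) = n := Complex.conj_ofReal n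
  have sc : star (c : ℂ) = c := Complex.conj_ofReal c
  have hσ : ((n * (1 - k) : ℝ) : ℂ) = -(n * E * (γ + γ ^ 2)) := by
    push_cast; rw [hk]; ring
  -- Since |1 - k|² = |E|²|1 + γ|² = |E|²(2 + 2 Re γ), this is where Re γ < -1/2 enters.
  have hgram : (n * (1 - k)) ^ 2 < Complex.normSq (n * E) := by
    have e1 : (((n * (1 - k)) ^ 2 : ℝ) : ℂ) = Complex.normSq (n * E) * (2 + 2 * γ.re : ℝ) := by
      have h2 : ((2 + 2 * γ.re : ℝ) : ℂ) = 2 + (γ + star γ) := by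
        push_cast
        rw [Complex.star_def, Complex.add_conj]; push_cast; ring
      rw [h2, Complex.normSq_eq_conj_mul_self, starRingEnd_apply, star_mul', sn, sE, sγ,
        Complex.ofReal_pow, hσ]
      field_simp
      ring
    have e2 : (n * (1 - k)) ^ 2 = Complex.normSq (n * E) * (2 + 2 * γ.re) := by exact_mod_cast e1
    have e3 : 0 < Complex.normSq (n * E) := Complex.normSq_pos.2 (mul_ne_zero hn0 hE0)
    rw [e2]
    nlinarith
  obtain ⟨s, t, hsq, htq, hss, htt, hst⟩ := exists_pair_of_gram hq _ _ hgram
  rw [hσ] at hss htt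
  have hts : herm t s = n * E * γ ^ 3 := by
    rw [← star_herm, hst, star_mul', sn, sE]; ring
  have hqs : herm q s = 0 := by rw [← star_herm, hsq, star_zero]
  have hqt : herm q t = 0 := by rw [← star_herm, htq, star_zero]
  obtain ⟨p₁, hp₁⟩ : ∃ p, p = (c : ℂ) • q + s := ⟨_, rfl⟩
  obtain ⟨p₂, hp₂⟩ : ∃ p, p = (c : ℂ) • q + t := ⟨_, rfl⟩
  -- Chosen so that p₁ + γ⁻¹p₂ + γ⁻²p₃ is a multiple of q.
  obtain ⟨p₃, hp₃⟩ : ∃ p, p = (c : ℂ) • q + ((-γ ^ 2) • s + (-γ) • t) := ⟨_, rfl⟩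
  have expand : ∀ x : V, herm x p₁ = c * herm x q + herm x s ∧
      herm x p₂ = c * herm x q + herm x t ∧
      herm x p₃ = c * herm x q + (-(γ⁻¹ ^ 2 * herm x s) - γ⁻¹ * herm x t) := by
    intro x
    rw [hp₁, hp₂, hp₃]
    simp only [herm_add_right, herm_smul_right, sc, star_neg, star_pow, sγ]
    refine ⟨trivial, trivial, by ring⟩
  have q₁ : herm q p₁ = c * N ∧ herm q p₂ = c * N ∧ herm q p₃ = c * N := by
    obtain ⟨a, b, d⟩ := expand q
    rw [a, b, d, hqs, hqt, hN]
    refine ⟨by ring, by ring, by ring⟩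
  have s₁ : herm s p₁ = n * (-E * (γ + γ ^ 2)) ∧ herm s p₂ = n * E ∧ herm s p₃ = n * E := by
    obtain ⟨a, b, d⟩ := expand s
    rw [a, b, d, hsq, hss, hst]
    refine ⟨by ring, by ring, by field_simp; ring⟩
  have t₁ : herm t p₁ = n * (E * γ ^ 3) ∧ herm t p₂ = n * (-E * (γ + γ ^ 2)) ∧
      herm t p₃ = n * E := by
    obtain ⟨a, b, d⟩ := expand t
    rw [a, b, d, htq, hts, htt]
    refine ⟨by ring, by ring, by field_simp; ring⟩
  have hcN : (c : ℂ) * (c * N) = n * k := by rw [← hcc]; ring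
  have h11 : herm p₁ p₁ = n := by
    conv_lhs => rw [hp₁]
    rw [herm_add_left, herm_smul_left, ← hp₁, q₁.1, s₁.1, hcN, hk]; ring
  have h12 : herm p₁ p₂ = n * (k + E) := by
    rw [hp₁, herm_add_left, herm_smul_left, q₁.2.1, s₁.2.1, hcN]; ring
  have h13 : herm p₁ p₃ = n * (k + E) := by
    rw [hp₁, herm_add_left, herm_smul_left, q₁.2.2, s₁.2.2, hcN]; ring
  have h22 : herm p₂ p₂ = n := by
    conv_lhs => rw [hp₂]
    rw [herm_add_left, herm_smul_left, ← hp₂, q₁.2.1, t₁.2.1, hcN, hk]; ring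
  have h23 : herm p₂ p₃ = n * (k + E) := by
    rw [hp₂, herm_add_left, herm_smul_left, q₁.2.2, t₁.2.2, hcN]; ring
  have h33 : herm p₃ p₃ = n := by
    conv_lhs => rw [hp₃]
    rw [herm_add_left, herm_add_left, herm_smul_left, herm_smul_left, herm_smul_left, ← hp₃,
      q₁.2.2, s₁.2.2, t₁.2.2, hcN, hk]; ring
  have hνα : (1 - (α ^ 3)⁻¹) * (k + E) = 1 - γ⁻¹ := by rw [← hw]; exact hν
  have triple := fun x u₁ u₂ u₃ => R_triple_mulVec hα0 h11 h22 h33 hn0 h12 h13 h23 hνα x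
    (u₁ := u₁) (u₂ := u₂) (u₃ := u₃)
  refine ⟨p₁, p₂, p₃, ?_, ?_, ?_, matrix_eq_of_mulVec_eq hq0 hsq htq ?_ ?_ ?_ ?_⟩
  · rw [IsNonisotropic, h11]; exact hn0
  · rw [IsNonisotropic, h22]; exact hn0
  · rw [IsNonisotropic, h33]; exact hn0
  · have : herm s s * herm t t - herm s t * herm t s =
        (((n * (1 - k)) ^ 2 - Complex.normSq (n * E) : ℝ) : ℂ) := by
      rw [← star_herm s t, hst, hss, htt, ← hσ, Complex.ofReal_sub,
        Complex.normSq_eq_conj_mul_self, starRingEnd_apply]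
      push_cast
      ring
    rw [this, Complex.ofReal_ne_zero]
    linarith
  · have hu : (c : ℂ) * N = n * (n * (c * N)) := by rw [← mul_assoc, hnc, one_mul]
    rw [triple q (n * (c * N)) (n * (c * N)) (n * (c * N)) (by rw [q₁.1, ← hu])
      (by rw [q₁.2.1, ← hu]) (by rw [q₁.2.2, ← hu]), R_mulVec_self hq0, hp₁, hp₂, hp₃, ← hw]
    -- At x = q the coefficients of p₁, p₂, p₃ are in ratio 1 : γ⁻¹ : γ⁻², so only the q-component
    -- survives.
    have hq' : w + (1 - w) * (n * (c * N)) * (1 + γ⁻¹ + γ⁻¹ ^ 2) * c = γ⁻¹ ^ 2 := by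
      have : (n : ℂ) * (c * N) * c = k := by
        rw [mul_assoc, mul_comm _ (c : ℂ), hcN, ← mul_assoc, hnc, one_mul]
      linear_combination hkk + (1 - w) * (1 + γ⁻¹ + γ⁻¹ ^ 2) * this
    rw [← hq']
    have hγi : γ * γ⁻¹ = 1 := mul_inv_cancel₀ hγ0
    generalize γ⁻¹ = g at *
    match_scalars
    · ring
    · linear_combination (-(1 - w) * n * c * N * (1 + γ * g)) * hγi
    · linear_combination (-(1 - w) * n * c * N * g) * hγi
  · rw [triple s _ _ _ s₁.1 s₁.2.1 s₁.2.2, R_mulVec_of_herm_eq_zero hsq, hp₁, hp₂, hp₃, ← hw]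
    -- The coefficients of the three centers sum to zero, so their common q-component cancels; the
    -- same happens for t.
    have k₂ : E - (1 - γ⁻¹) * (-E * (γ + γ ^ 2)) = E * γ ^ 2 := by field_simp; ring
    have k₃ : E - (1 - γ⁻¹) * E - (1 - γ⁻¹) * γ⁻¹ * (-E * (γ + γ ^ 2)) = E * γ := by
      field_simp; ring
    rw [k₂, k₃]
    match_scalars
    · linear_combination -hET'
    · ring
    · ring
  · rw [triple t _ _ _ t₁.1 t₁.2.1 t₁.2.2, R_mulVec_of_herm_eq_zero htq, hp₁, hp₂, hp₃, ← hw]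
    have k₂ : -E * (γ + γ ^ 2) - (1 - γ⁻¹) * (E * γ ^ 3) = -E * (γ + γ ^ 3) := by
      field_simp; ring
    have k₃ : E - (1 - γ⁻¹) * (-E * (γ + γ ^ 2)) - (1 - γ⁻¹) * γ⁻¹ * (E * γ ^ 3) = E * γ := by
      field_simp; ring
    rw [k₂, k₃]
    match_scalars
    · linear_combination -hET'
    · ring
    · ring

/-! ### Scalars and passage to PU(2,1) -/

/-- The scalar matrix of a cube root of unity, as an element of `SU(2,1)`. -/
def scalarSU21 (δ : ℂ) (h : δ ^ 3 = 1) : SU21 :=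
  ⟨⟨δ • 1, by simp [h]⟩, by
    intro x y
    have hδ : ‖δ‖ = 1 := Complex.norm_eq_one_of_pow_eq_one h three_ne_zero
    have h0 : δ ≠ 0 := by rintro rfl; simp at h
    simp only [smul_mulVec, one_mulVec, herm_smul_left, herm_smul_right,
      star_eq_inv_of_norm_eq_one hδ]
    field_simp⟩

/-- Both eigenvalues scale by δ, because δ⁻² = δ; hence β may be replaced by δβ without changing the
isometry. -/
theorem R_mul_of_pow_three_eq_one {δ : ℂ} (h : δ ^ 3 = 1) (β : ℂ) (q : V) :
    R (δ * β) q = δ • R β q := by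
  have h0 : δ ≠ 0 := by rintro rfl; simp at h
  have h2 : δ⁻¹ ^ 2 = δ := by field_simp; exact h.symm
  rw [R, R, mul_inv, mul_pow, h2, smul_add, smul_smul, smul_smul]
  congr 2
  ring

end ComplexHyperbolic

theorem mainTheorem7 (α : ℂ) (hα : ComplexHyperbolic.IsParameter α)
    (F : ComplexHyperbolic.PU21) (hF : ComplexHyperbolic.IsSpecialElliptic F)
    (hcenter : ∃ q : ComplexHyperbolic.V,
      ComplexHyperbolic.IsPositive q ∧ ComplexHyperbolic.HasCenter F q) :
    ComplexHyperbolic.AdmitsPowDecomposition α 3 F := by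
  obtain ⟨q, hq, -, β, hβ, A, hA, hAR⟩ := hcenter
  obtain ⟨δ, hδ, hre⟩ := ComplexHyperbolic.exists_cube_root_mul_re_lt hβ
  have hnorm : ‖δ * β‖ = 1 := by
    rw [norm_mul, hβ.1, Complex.norm_eq_one_of_pow_eq_one hδ three_ne_zero, one_mul]
  obtain ⟨p₁, p₂, p₃, h₁, h₂, h₃, hp⟩ :=
    ComplexHyperbolic.exists_R_triple_eq hα hnorm hre hq
  refine ⟨A * ComplexHyperbolic.scalarSU21 δ hδ, ?_, ![p₁, p₂, p₃], ?_, ?_⟩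
  · rw [ComplexHyperbolic.IsLift] at hA ⊢
    rw [← hA]
    exact QuotientGroup.mk_mul_of_mem A ⟨δ, rfl⟩
  · intro i
    fin_cases i
    exacts [h₁, h₂, h₃]
  · have hmul : ComplexHyperbolic.toMat (A * ComplexHyperbolic.scalarSU21 δ hδ) =
        ComplexHyperbolic.toMat A * (δ • 1) := rfl
    rw [hmul, hAR, mul_smul_comm, mul_one, ← ComplexHyperbolic.R_mul_of_pow_three_eq_one hδ, ← hp]
    simp [List.ofFn_succ, mul_assoc]
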